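/- **Puzzles.** All grids are rectangular; two cells are adjacent if they share a side, and a path is a sequence of distinct cells, consecutive ones adjacent. *Numberlink.* An $m\times n$ Numberlink puzzle with $p$ pairs is an $m\times n$ grid in which some cells contain one of the numbers $1,\dots,p$, each number occurring in exactly two cells. A solution consists of one path for each number $i$, joining the two cells with number $i$, such that no two of these paths share a cell. It is not required that all cells are covered. *Wataridori.* A Wataridori puzzle is a rectangular grid partitioned into polyominoes, called regions, in which some cells contain a circle, and some circles contain a number. A solution is a set of paths, no two sharing a cell, each joining two different circles, such that every circle is an end of a path and every end of a path is a circle; no path returns to a region after leaving it; and a number in an end circle of a path equals the number of regions through which the path passes (so two numbered circles joined by a path carry the same number, and a circle without a number can stand for any number). **Construction.** Let $G$ be an $m\times n$ Numberlink puzzle with $p$ pairs, let $k=\lceil (p-1)/2\rceil$ and $c=2k+2$. The Wataridori puzzle $H$ of size $(4k+5)m\times(4k+5)n$ is obtained by replacing each cell of $G$ by a $(4k+5)\times(4k+5)$ block, in the same arrangement: an *empty block* for an empty cell, a *number block* for a cell with a number. Rows of a block are numbered $0,\dots,4k+4$ from the top and columns $0,\dots,4k+4$ from the left; the center is $(c,c)$.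 *Empty block.* The middle row and the middle column (row $c$ and column $c$) form one piece, the road; the four remaining $(2k+2)\times(2k+2)$ corner squares are four further pieces. Every cell on the boundary of a corner square contains a circle with number $1$; there are no other circles. *Number block.* Each cell of the following four strips is a region by itself: rows $c-1,c$ and columns $1,\dots,2k$; rows $c,c+1$ and columns $c+2,\dots,4k+3$; rows $1,\dots,2k$ and columns $c,c+1$; rows $c+2,\dots,4k+3$ and columns $c-1,c$. (For $k=0$ the strips are empty.) The center and its four neighbours form one region. The remaining cells of the middle row and column, namely the four cells $(c,0),(c,4k+4),(0,c),(4k+4,c)$, are road cells. What remains of each of the four corner squares is one region. Circles with number $1$ are in all cells that lie on the boundary of a corner square and in no strip, and in the cells of the corner squares next to the strips: row $c-2$, columns $1,\dots,2k$; row $c+2$, columns $c+2,\dots,4k+3$; column $c+2$, rows $1,\dots,2k$; column $c-2$, rows $c+2,\dots,4k+3$. If the cell of $G$ has number $i$, the center contains a circle with number $4k+2i+1$. There are no other circles. In $H$, the regions of different blocks are different, except that road cells that are adjacent across the border of two blocks belong to the same region; that is, the road cells of all blocks are partitioned into their connected components, each of which is a region. **Theorem.** For all $m,n,p$ and every $m\times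 n$ Numberlink puzzle $G$ with $p$ pairs, $G$ has a solution if and only if $H$ has a solution. -/

import Mathlib

/-- The `m × n` rectangular grid: cells are pairs (row, column), rows counted from the top and
columns from the left; two cells are adjacent iff they are horizontal or vertical neighbours. -/
abbrev grid (m n : ℕ) : SimpleGraph (Fin m × Fin n) :=
  SimpleGraph.boxProd (SimpleGraph.pathGraph m) (SimpleGraph.pathGraph n)

/-! ### Numberlink -/

/-- An `m × n` Numberlink puzzle with `p` pairs. A cell is empty (`none`) or contains one of the
numbers `1, …, p`; the number `i + 1` is encoded by `i : Fin p`. Each number occurs exactly twice. -/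
structure Numberlink (m n p : ℕ) where
  label : Fin m × Fin n → Option (Fin p)
  twice : ∀ i : Fin p, {c | label c = some i}.ncard = 2

/-- Solvability, in the variant where cells need not all be covered: for every number there is a
path joining its two cells, and distinct paths share no cell. -/
def Numberlink.Solvable {m n p : ℕ} (G : Numberlink m n p) : Prop :=
  ∃ (s t : Fin p → Fin m × Fin n) (P : ∀ i : Fin p, (grid m n).Path (s i) (t i)),
    (∀ i, s i ≠ t i ∧ G.label (s i) = some i ∧ G.label (t i) = some i) ∧
    (∀ i j, i ≠ j → ∀ c, c ∈ (P i).1.support → c ∉ (P j).1.support)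

/-! ### Wataridori -/

/-- Content of a Wataridori cell: no circle, a circle without a number, a circle with a number. -/
inductive Mark where
  | blank : Mark
  | wild : Mark
  | num (x : ℕ) : Mark
  deriving DecidableEq

/-- An `M × N` Wataridori puzzle: the grid is partitioned into polyominoes (the classes of
`region`, which are connected sets of cells), and some cells contain circles. -/
structure Wataridori (M N : ℕ) where
  region : Setoid (Fin M × Fin N)
  polyomino : ∀ c, ((grid M N).induce {d | region c d}).Connected
  mark : Fin M × Fin N → Mark

namespace Wataridori

variable {M N : ℕ} (H : Wataridori M N)

/-- The walk never comes back to a region after having left it. -/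
def NoReentry {u v : Fin M × Fin N} (w : (grid M N).Walk u v) : Prop :=
  ∀ a b c : ℕ, a ≤ b → b ≤ c → c ≤ w.length →
    H.region (w.getVert a) (w.getVert c) → H.region (w.getVert a) (w.getVert b)

/-- The number of regions through which the walk passes. -/
noncomputable def regionCount {u v : Fin M × Fin N} (w : (grid M N).Walk u v) : ℕ :=
  {q : Quotient H.region | ∃ c ∈ w.support, Quotient.mk H.region c = q}.ncard

/-- Solvability: there is a family of paths, no two of them sharing a cell, whose end cells are
exactly the cells with circles, such that no path re-enters a region and every number in an end
circle of a path is the number of regions the path passes through. (In particular the numbers at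
the two ends agree, where a circle without a number stands for any number.) -/
def Solvable : Prop :=
  ∃ (ι : Type) (s t : ι → Fin M × Fin N) (P : ∀ j : ι, (grid M N).Path (s j) (t j)),
    (∀ j, s j ≠ t j) ∧
    (∀ c, H.mark c ≠ Mark.blank ↔ ∃ j, c = s j ∨ c = t j) ∧
    (∀ i j, i ≠ j → ∀ c, c ∈ (P i).1.support → c ∉ (P j).1.support) ∧
    (∀ j, H.NoReentry (P j).1) ∧
    (∀ j x, H.mark (s j) = Mark.num x ∨ H.mark (t j) = Mark.num x → H.regionCount (P j).1 = x)

end Wataridori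

/-! ### The blocks

A block has `4k+5` rows and columns, numbered `0, …, 4k+4`; its center is `(2k+2, 2k+2)`. -/

/-- The pieces of which a block consists. -/
inductive Piece where
  /-- The middle row and column of an empty block; the four outermost cells of these in a number
  block. Not separated from the road of a neighbouring block. -/
  | road : Piece
  /-- The four corner pieces (upper or lower, left or right). -/
  | corner (upper left : Bool) : Piece
  /-- The center of a number block together with its four neighbours. -/
  | core : Piece
  /-- A one-cell region of a number block. -/
  | single (r c : ℕ) : Piece
  deriving DecidableEq

/-- The one-cell regions of a number block: on each side of the center, a `2 × 2k` strip. -/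
abbrev IsSingle (k r c : ℕ) : Prop :=
  (1 ≤ c ∧ c ≤ 2 * k ∧ (r = 2 * k + 1 ∨ r = 2 * k + 2)) ∨
  (2 * k + 4 ≤ c ∧ c ≤ 4 * k + 3 ∧ (r = 2 * k + 2 ∨ r = 2 * k + 3)) ∨
  (1 ≤ r ∧ r ≤ 2 * k ∧ (c = 2 * k + 2 ∨ c = 2 * k + 3)) ∨
  (2 * k + 4 ≤ r ∧ r ≤ 4 * k + 3 ∧ (c = 2 * k + 1 ∨ c = 2 * k + 2))

/-- The center of a block and its four neighbours. -/
abbrev IsCore (k r c : ℕ) : Prop :=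
  (r = 2 * k + 2 ∧ 2 * k + 1 ≤ c ∧ c ≤ 2 * k + 3) ∨
  (c = 2 * k + 2 ∧ 2 * k + 1 ≤ r ∧ r ≤ 2 * k + 3)

/-- The piece to which the cell `(r, c)` of an empty block belongs. -/
def emptyPiece (k r c : ℕ) : Piece :=
  if r = 2 * k + 2 ∨ c = 2 * k + 2 then Piece.road
  else Piece.corner (decide (r < 2 * k + 2)) (decide (c < 2 * k + 2))

/-- The piece to which the cell `(r, c)` of a number block belongs. -/
def numberPiece (k r c : ℕ) : Piece :=
  if IsSingle k r c then Piece.single r c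
  else if IsCore k r c then Piece.core
  else emptyPiece k r c

/-- The rows (or columns) at the border of the block or next to its middle row (or column). -/
abbrev IsRim (k x : ℕ) : Prop :=
  x = 0 ∨ x = 2 * k + 1 ∨ x = 2 * k + 3 ∨ x = 4 * k + 4

/-- The circles of an empty block: number 1 all along the boundary of each corner square. -/
def emptyMark (k r c : ℕ) : Mark :=
  if r ≠ 2 * k + 2 ∧ c ≠ 2 * k + 2 ∧ (IsRim k r ∨ IsRim k c) then Mark.num 1 else Mark.blank

/-- The cells of the corner pieces of a number block that lie directly behind the singles. -/
abbrev IsBehind (k r c : ℕ) : Prop :=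
  (1 ≤ c ∧ c ≤ 2 * k ∧ r = 2 * k) ∨
  (2 * k + 4 ≤ c ∧ c ≤ 4 * k + 3 ∧ r = 2 * k + 4) ∨
  (1 ≤ r ∧ r ≤ 2 * k ∧ c = 2 * k + 4) ∨
  (2 * k + 4 ≤ r ∧ r ≤ 4 * k + 3 ∧ c = 2 * k)

/-- The circles of a number block with number `x` in the center: the remaining circles carry the
number 1 and run all along the boundary of each corner piece. -/
def numberMark (k x r c : ℕ) : Mark :=
  if r = 2 * k + 2 ∧ c = 2 * k + 2 then Mark.num x
  else if IsSingle k r c then Mark.blank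
  else if IsBehind k r c then Mark.num 1
  else emptyMark k r c

/-! ### The Wataridori puzzle of a Numberlink puzzle -/

namespace Numberlink

variable {m n p : ℕ} (G : Numberlink m n p) (k : ℕ)

/-- The cell of the Numberlink puzzle in whose block the given cell lies. -/
def block (a : Fin ((4 * k + 5) * m) × Fin ((4 * k + 5) * n)) : Fin m × Fin n :=
  (⟨a.1.val / (4 * k + 5), Nat.div_lt_of_lt_mul a.1.isLt⟩,
   ⟨a.2.val / (4 * k + 5), Nat.div_lt_of_lt_mul a.2.isLt⟩)

/-- The piece of its block to which the given cell belongs. -/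
def piece (a : Fin ((4 * k + 5) * m) × Fin ((4 * k + 5) * n)) : Piece :=
  match G.label (block k a) with
  | none => emptyPiece k (a.1.val % (4 * k + 5)) (a.2.val % (4 * k + 5))
  | some _ => numberPiece k (a.1.val % (4 * k + 5)) (a.2.val % (4 * k + 5))

/-- Adjacent cells without a region border between them. -/
def openGraph : SimpleGraph (Fin ((4 * k + 5) * m) × Fin ((4 * k + 5) * n)) where
  Adj a b := (grid ((4 * k + 5) * m) ((4 * k + 5) * n)).Adj a b ∧ G.piece k a = G.piece k b ∧
    (block k a = block k b ∨ G.piece k a = Piece.road)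
  symm := ⟨fun _ _ h => ⟨h.1.symm, h.2.1.symm, h.2.2.imp Eq.symm fun e => h.2.1 ▸ e⟩⟩
  loopless := ⟨fun _ h => h.1.ne rfl⟩

theorem connected_induce_reachable {V : Type*} {A B : SimpleGraph V} (h : A ≤ B) (c : V) :
    (B.induce {d | A.Reachable c d}).Connected := by
  have key : ∀ d (w : A.Walk c d), (B.induce {d | A.Reachable c d}).Reachable
      ⟨c, SimpleGraph.Reachable.refl c⟩ ⟨d, w.reachable⟩ := by
    intro d w
    induction w using SimpleGraph.Walk.concatRec with
    | Hnil => exact SimpleGraph.Reachable.refl _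
    | Hconcat w e ih =>
      refine ih.trans (SimpleGraph.Adj.reachable ?_)
      exact h e
  rw [SimpleGraph.connected_iff_exists_forall_reachable]
  exact ⟨⟨c, SimpleGraph.Reachable.refl c⟩, fun ⟨d, ⟨w⟩⟩ => key d w⟩

/-- The puzzle obtained by replacing every cell by its `(4k+5) × (4k+5)` block. The regions are
the connected components left after cutting along the borders. The center circle of the block of
a cell with number `j = i + 1` carries the number `4k + 2j + 1`. -/
def toWataridori : Wataridori ((4 * k + 5) * m) ((4 * k + 5) * n) where
  region := (G.openGraph k).reachableSetoid
  polyomino := connected_induce_reachable fun _ _ h => h.1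
  mark a := match G.label (block k a) with
    | none => emptyMark k (a.1.val % (4 * k + 5)) (a.2.val % (4 * k + 5))
    | some i => numberMark k (4 * k + 2 * (i.val + 1) + 1)
        (a.1.val % (4 * k + 5)) (a.2.val % (4 * k + 5))

end Numberlink

/-!
Let `G` be a Numberlink puzzle and `H` the Wataridori puzzle made of its blocks.

The circles with number 1 line every corner piece, so that a path which starts at the center of a
number block can never enter a corner: it is confined to the cross-shaped remainder of the blocks,
a center with four arms. In a given solution of `H`, all circles are ends of paths, the two ends of
a path carry the same number, and the numbers in the centers exceed 1; hence for every number of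
`G` there is a path between the two centers with this number. As it does not revisit cells, it
leaves every arm that it enters from outside at the center of the block, so it moves from center to
center of adjacent blocks (`exists_walk_of_center_path`). Two such paths share no center, so the
blocks whose centers they visit give disjoint walks in `G` (`solvable_of_toWataridori_solvable`).
Neither the ban on re-entering regions nor the exact numbers of regions matter here.

Conversely, a path of a solution of `G` runs through empty cells between its ends. In `H`, it is
traced along the road, which contributes a single region, and along one arm of each of the two end
blocks. A path through the strip of an arm meets `2 k + 2 j` one-cell regions if it uses both lanes
in `2 j` of the columns, where `j ≤ k` can be chosen freely. With the two cores, this gives every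
number of regions `4 k + 3 + 2 i` for `i ≤ 2 k` (`exists_link`), and these are the numbers in the
centers because `p ≤ 2 k + 1`. The circles with number 1 lie on one cycle of even length per corner
piece and are joined in adjacent pairs within their regions (`mate_spec`).
-/

namespace Numberlink

variable {m n p : ℕ}

/-! ### Coordinates inside a block -/

/-- The row of a cell inside its block. -/
abbrev row (k : ℕ) (a : Fin ((4 * k + 5) * m) × Fin ((4 * k + 5) * n)) : ℕ := a.1.val % (4 * k + 5)

/-- The column of a cell inside its block. -/
abbrev col (k : ℕ) (a : Fin ((4 * k + 5) * m) × Fin ((4 * k + 5) * n)) : ℕ := a.2.val % (4 * k + 5)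

theorem mul_add_min_lt {k m x : ℕ} (hx : x < m) (r : ℕ) :
    (4 * k + 5) * x + min r (4 * k + 4) < (4 * k + 5) * m := by
  have h1 : (4 * k + 5) * (x + 1) ≤ (4 * k + 5) * m := Nat.mul_le_mul_left _ hx
  have h2 : min r (4 * k + 4) ≤ 4 * k + 4 := min_le_right _ _
  rw [Nat.mul_add] at h1
  omega

/-- The cell with row `r` and column `c` of the block of `X`; coordinates beyond the block are
cut off at its last row or column. -/
def cell (k : ℕ) (X : Fin m × Fin n) (r c : ℕ) :
    Fin ((4 * k + 5) * m) × Fin ((4 * k + 5) * n) :=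
  (⟨(4 * k + 5) * X.1.val + min r (4 * k + 4), mul_add_min_lt X.1.isLt r⟩,
   ⟨(4 * k + 5) * X.2.val + min c (4 * k + 4), mul_add_min_lt X.2.isLt c⟩)

/-- The center cell of the block of `X`. -/
abbrev center (k : ℕ) (X : Fin m × Fin n) : Fin ((4 * k + 5) * m) × Fin ((4 * k + 5) * n) :=
  cell k X (2 * k + 2) (2 * k + 2)

@[simp] theorem block_cell (k : ℕ) (X : Fin m × Fin n) (r c : ℕ) : block k (cell k X r c) = X := by
  have h : ∀ x y : ℕ, ((4 * k + 5) * x + min y (4 * k + 4)) / (4 * k + 5) = x := fun x y => by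
    rw [Nat.mul_add_div (by omega), Nat.div_eq_of_lt (by omega), add_zero]
  ext <;> simp [block, cell, h]

theorem row_cell {k : ℕ} (X : Fin m × Fin n) {r : ℕ} (c : ℕ) (hr : r ≤ 4 * k + 4) :
    row k (cell k X r c) = r := by
  simp only [row, cell, Nat.mul_add_mod, min_eq_left hr]
  exact Nat.mod_eq_of_lt (by omega)

theorem col_cell {k : ℕ} (X : Fin m × Fin n) (r : ℕ) {c : ℕ} (hc : c ≤ 4 * k + 4) :
    col k (cell k X r c) = c := by
  simp only [col, cell, Nat.mul_add_mod, min_eq_left hc]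
  exact Nat.mod_eq_of_lt (by omega)

theorem row_le (k : ℕ) (a : Fin ((4 * k + 5) * m) × Fin ((4 * k + 5) * n)) :
    row k a ≤ 4 * k + 4 := by
  have := Nat.mod_lt a.1.val (show 0 < 4 * k + 5 by omega)
  simp only [row]; omega

theorem col_le (k : ℕ) (a : Fin ((4 * k + 5) * m) × Fin ((4 * k + 5) * n)) :
    col k a ≤ 4 * k + 4 := by
  have := Nat.mod_lt a.2.val (show 0 < 4 * k + 5 by omega)
  simp only [col]; omega

theorem cell_block (k : ℕ) (a : Fin ((4 * k + 5) * m) × Fin ((4 * k + 5) * n)) :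
    cell k (block k a) (row k a) (col k a) = a := by
  have h1 := min_eq_left (row_le k a)
  have h2 := min_eq_left (col_le k a)
  ext
  · simp only [cell, block, h1]; exact Nat.div_add_mod _ _
  · simp only [cell, block, h2]; exact Nat.div_add_mod _ _

theorem cell_ext {k : ℕ} {a b : Fin ((4 * k + 5) * m) × Fin ((4 * k + 5) * n)}
    (h : block k a = block k b) (hr : row k a = row k b) (hc : col k a = col k b) : a = b := by
  rw [← cell_block k a, ← cell_block k b, h, hr, hc]

theorem eq_cell_iff {k : ℕ} {a : Fin ((4 * k + 5) * m) × Fin ((4 * k + 5) * n)} {X : Fin m × Fin n}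
    {r c : ℕ} (hr : r ≤ 4 * k + 4) (hc : c ≤ 4 * k + 4) :
    a = cell k X r c ↔ block k a = X ∧ row k a = r ∧ col k a = c := by
  constructor
  · rintro rfl
    exact ⟨block_cell _ _ _ _, row_cell _ _ hr, col_cell _ _ hc⟩
  · rintro ⟨rfl, rfl, rfl⟩
    exact (cell_block k a).symm

theorem center_injective (k : ℕ) : Function.Injective (center k : Fin m × Fin n → _) :=
  fun X Y h => by simpa using congrArg (block k) h

theorem grid_adj {a b : Fin m × Fin n} : (grid m n).Adj a b ↔
    (a.1.val = b.1.val ∧ (a.2.val + 1 = b.2.val ∨ b.2.val + 1 = a.2.val)) ∨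
    (a.2.val = b.2.val ∧ (a.1.val + 1 = b.1.val ∨ b.1.val + 1 = a.1.val)) := by
  simp only [SimpleGraph.boxProd_adj, SimpleGraph.pathGraph_adj, Fin.ext_iff]
  tauto

/-- Two positions inside a block that share a side. -/
abbrev LocalAdj (r c r' c' : ℕ) : Prop :=
  (r = r' ∧ (c + 1 = c' ∨ c' + 1 = c)) ∨ (c = c' ∧ (r + 1 = r' ∨ r' + 1 = r))

/-- The blocks of `X` and `Y` share a side, and the positions `(r, c)` in the former and
`(r', c')` in the latter are adjacent across it. -/
abbrev AcrossBorder (k : ℕ) (X Y : Fin m × Fin n) (r c r' c' : ℕ) : Prop :=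
  (X.1.val = Y.1.val ∧ r = r' ∧ (X.2.val + 1 = Y.2.val ∧ c = 4 * k + 4 ∧ c' = 0 ∨
    Y.2.val + 1 = X.2.val ∧ c = 0 ∧ c' = 4 * k + 4)) ∨
  (X.2.val = Y.2.val ∧ c = c' ∧ (X.1.val + 1 = Y.1.val ∧ r = 4 * k + 4 ∧ r' = 0 ∨
    Y.1.val + 1 = X.1.val ∧ r = 0 ∧ r' = 4 * k + 4))

theorem div_mod_of_succ {l x y : ℕ} (hl : 0 < l) (h : x + 1 = y) :
    (x / l = y / l ∧ x % l + 1 = y % l) ∨ (x / l + 1 = y / l ∧ x % l + 1 = l ∧ y % l = 0) := by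
  subst h
  have hx := Nat.div_add_mod x l
  have hlt := Nat.mod_lt x hl
  by_cases hc : x % l + 1 = l
  · right
    have e : x + 1 = l * (x / l + 1) := by rw [Nat.mul_add]; omega
    refine ⟨?_, hc, ?_⟩
    · rw [e, Nat.mul_div_cancel_left _ hl]
    · rw [e, Nat.mul_mod_right]
  · left
    have e : x + 1 = l * (x / l) + (x % l + 1) := by omega
    constructor
    · conv_rhs => rw [e, Nat.mul_add_div hl, Nat.div_eq_of_lt (show x % l + 1 < l by omega)]
      simp
    · conv_rhs => rw [e, Nat.mul_add_mod, Nat.mod_eq_of_lt (show x % l + 1 < l by omega)]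

theorem adj_cases {k : ℕ} {a b : Fin ((4 * k + 5) * m) × Fin ((4 * k + 5) * n)}
    (h : (grid _ _).Adj a b) :
    (block k a = block k b ∧ LocalAdj (row k a) (col k a) (row k b) (col k b)) ∨
    AcrossBorder k (block k a) (block k b) (row k a) (col k a) (row k b) (col k b) := by
  have hl : 0 < 4 * k + 5 := by omega
  rw [grid_adj] at h
  have hb : block k a = block k b ↔ a.1.val / (4 * k + 5) = b.1.val / (4 * k + 5) ∧
      a.2.val / (4 * k + 5) = b.2.val / (4 * k + 5) := by
    simp only [block, Prod.ext_iff, Fin.ext_iff]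
  rw [hb]
  simp only [block, AcrossBorder]
  unfold row col
  rcases h with ⟨e, h | h⟩ | ⟨e, h | h⟩ <;> rw [e] <;>
    rcases div_mod_of_succ hl h with ⟨h1, h2⟩ | ⟨h1, h2, h3⟩
  · exact Or.inl ⟨⟨rfl, h1⟩, Or.inl ⟨rfl, Or.inl h2⟩⟩
  · exact Or.inr (Or.inl ⟨rfl, rfl, Or.inl ⟨h1, by omega, h3⟩⟩)
  · exact Or.inl ⟨⟨rfl, h1.symm⟩, Or.inl ⟨rfl, Or.inr h2⟩⟩
  · exact Or.inr (Or.inl ⟨rfl, rfl, Or.inr ⟨h1, h3, by omega⟩⟩)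
  · exact Or.inl ⟨⟨h1, rfl⟩, Or.inr ⟨rfl, Or.inl h2⟩⟩
  · exact Or.inr (Or.inr ⟨rfl, rfl, Or.inl ⟨h1, by omega, h3⟩⟩)
  · exact Or.inl ⟨⟨h1.symm, rfl⟩, Or.inr ⟨rfl, Or.inr h2⟩⟩
  · exact Or.inr (Or.inr ⟨rfl, rfl, Or.inr ⟨h1, h3, by omega⟩⟩)

theorem adj_cell {k : ℕ} (X : Fin m × Fin n) {r c r' c' : ℕ} (hr : r ≤ 4 * k + 4)
    (hc : c ≤ 4 * k + 4) (hr' : r' ≤ 4 * k + 4) (hc' : c' ≤ 4 * k + 4) (h : LocalAdj r c r' c') :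
    (grid _ _).Adj (cell k X r c) (cell k X r' c') := by
  rw [grid_adj]
  simp only [cell, min_eq_left hr, min_eq_left hc, min_eq_left hr', min_eq_left hc']
  omega

/-! ### Arms -/

/-- The four sides of a block. -/
inductive Dir where
  | west | north | east | south

/-- The row of the position at distance `x` from the center on the arm in a given direction;
`h = 1` stands for the second lane of the arm, which the strips of a number block have. -/
def Dir.row (k : ℕ) : Dir → ℕ → ℕ → ℕ
  | west, _, h => 2 * k + 2 - h
  | north, x, _ => 2 * k + 2 - x
  | east, _, h => 2 * k + 2 + h
  | south, x, _ => 2 * k + 2 + x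

/-- The column of the position at distance `x` from the center, in lane `h` of an arm. -/
def Dir.col (k : ℕ) : Dir → ℕ → ℕ → ℕ
  | west, x, _ => 2 * k + 2 - x
  | north, _, h => 2 * k + 2 + h
  | east, x, _ => 2 * k + 2 + x
  | south, _, h => 2 * k + 2 - h

/-- The cell at distance `x` from the center, in lane `h` of an arm of the block of `X`. -/
def arm (k : ℕ) (X : Fin m × Fin n) (d : Dir) (x h : ℕ) :
    Fin ((4 * k + 5) * m) × Fin ((4 * k + 5) * n) :=
  cell k X (d.row k x h) (d.col k x h)

/-- The outermost cell of an arm. -/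
abbrev armEnd (k : ℕ) (X : Fin m × Fin n) (d : Dir) :
    Fin ((4 * k + 5) * m) × Fin ((4 * k + 5) * n) :=
  arm k X d (2 * k + 2) 0

@[simp] theorem block_arm (k : ℕ) (X : Fin m × Fin n) (d : Dir) (x h : ℕ) :
    block k (arm k X d x h) = X := block_cell _ _ _ _

theorem row_arm {k : ℕ} (X : Fin m × Fin n) (d : Dir) {x h : ℕ} (hx : x ≤ 2 * k + 2) (hh : h ≤ 1) :
    row k (arm k X d x h) = d.row k x h :=
  row_cell _ _ (by cases d <;> simp only [Dir.row] <;> omega)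

theorem col_arm {k : ℕ} (X : Fin m × Fin n) (d : Dir) {x h : ℕ} (hx : x ≤ 2 * k + 2) (hh : h ≤ 1) :
    col k (arm k X d x h) = d.col k x h :=
  col_cell _ _ (by cases d <;> simp only [Dir.col] <;> omega)

theorem arm_zero (k : ℕ) (X : Fin m × Fin n) (d : Dir) : arm k X d 0 0 = center k X := by
  cases d <;> rfl

theorem adj_arm {k : ℕ} (X : Fin m × Fin n) (d : Dir) {x h x' h' : ℕ} (hx : x ≤ 2 * k + 2)
    (hh : h ≤ 1) (hx' : x' ≤ 2 * k + 2) (hh' : h' ≤ 1) (e : LocalAdj x h x' h') :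
    (grid _ _).Adj (arm k X d x h) (arm k X d x' h') := by
  apply adj_cell <;> cases d <;> simp only [Dir.row, Dir.col] <;> omega

theorem exists_adj_armEnd {k : ℕ} {X Y : Fin m × Fin n} (h : (grid m n).Adj X Y) :
    ∃ d e, (grid _ _).Adj (armEnd k X d) (armEnd k Y e) := by
  rw [grid_adj] at h
  have key : ∀ x y : ℕ, x + 1 = y → (4 * k + 5) * x + (4 * k + 4) + 1 = (4 * k + 5) * y := by
    rintro x y rfl; ring
  have e1 : min (2 * k + 2 + (2 * k + 2)) (4 * k + 4) = 4 * k + 4 := by omega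
  rcases h with ⟨e, h | h⟩ | ⟨e, h | h⟩ <;> have := key _ _ h
  · refine ⟨.east, .west, grid_adj.2 ?_⟩
    simp only [armEnd, arm, cell, Dir.row, Dir.col, e, e1]; omega
  · refine ⟨.west, .east, grid_adj.2 ?_⟩
    simp only [armEnd, arm, cell, Dir.row, Dir.col, e, e1]; omega
  · refine ⟨.south, .north, grid_adj.2 ?_⟩
    simp only [armEnd, arm, cell, Dir.row, Dir.col, e, e1]; omega
  · refine ⟨.north, .south, grid_adj.2 ?_⟩
    simp only [armEnd, arm, cell, Dir.row, Dir.col, e, e1]; omega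

/-! ### Pieces and circles of a block -/

variable (G : Numberlink m n p) {k : ℕ} {a b : Fin ((4 * k + 5) * m) × Fin ((4 * k + 5) * n)}

theorem piece_of_none (h : G.label (block k a) = none) :
    G.piece k a = emptyPiece k (row k a) (col k a) := by
  simp only [piece, h]

theorem piece_of_some {i : Fin p} (h : G.label (block k a) = some i) :
    G.piece k a = numberPiece k (row k a) (col k a) := by
  simp only [piece, h]

theorem mark_of_none (h : G.label (block k a) = none) :
    (G.toWataridori k).mark a = emptyMark k (row k a) (col k a) := by
  simp only [toWataridori, h]

theorem mark_of_some {i : Fin p} (h : G.label (block k a) = some i) :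
    (G.toWataridori k).mark a =
      numberMark k (4 * k + 2 * (i.val + 1) + 1) (row k a) (col k a) := by
  simp only [toWataridori, h]

theorem mark_center {X : Fin m × Fin n} {i : Fin p} (h : G.label X = some i) :
    (G.toWataridori k).mark (center k X) = .num (4 * k + 2 * (i.val + 1) + 1) := by
  rw [G.mark_of_some (i := i) (by rwa [block_cell]), row_cell _ _ (by omega),
    col_cell _ _ (by omega)]
  simp [numberMark]

theorem mark_cases (a : Fin ((4 * k + 5) * m) × Fin ((4 * k + 5) * n)) :
    (G.toWataridori k).mark a = .blank ∨ (G.toWataridori k).mark a = .num 1 ∨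
    ∃ X i, a = center k X ∧ G.label X = some i := by
  rcases hX : G.label (block k a) with _ | i
  · rw [G.mark_of_none hX, emptyMark]
    split_ifs <;> simp
  · rw [G.mark_of_some hX, numberMark, emptyMark]
    split_ifs with h
    · right; right
      exact ⟨_, i, (eq_cell_iff (by omega) (by omega)).2 ⟨rfl, h⟩, hX⟩
    all_goals simp

/-! ### Paths that stay off the corners -/

/-- The cell belongs to none of the corner pieces of its block. -/
def OffCorner (a : Fin ((4 * k + 5) * m) × Fin ((4 * k + 5) * n)) : Prop :=
  row k a = 2 * k + 2 ∨ col k a = 2 * k + 2 ∨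
    (G.label (block k a) ≠ none ∧ IsSingle k (row k a) (col k a))

/-- The position lies in the part of a block between its center and its side in direction `d`.
Among the cells off the corners, this singles out the arm in direction `d`. -/
def Dir.Mem (k : ℕ) (r c : ℕ) : Dir → Prop
  | west => c ≤ 2 * k + 1 ∧ 2 * k + 1 ≤ r ∧ r ≤ 2 * k + 2
  | north => r ≤ 2 * k + 1 ∧ 2 * k + 2 ≤ c ∧ c ≤ 2 * k + 3
  | east => 2 * k + 3 ≤ c ∧ 2 * k + 2 ≤ r ∧ r ≤ 2 * k + 3
  | south => 2 * k + 3 ≤ r ∧ 2 * k + 1 ≤ c ∧ c ≤ 2 * k + 2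

variable {G}

theorem emptyMark_eq_one_iff {k r c : ℕ} : emptyMark k r c = .num 1 ↔
    ¬ (r = 2 * k + 2 ∨ c = 2 * k + 2) ∧ (IsRim k r ∨ IsRim k c) := by
  rw [emptyMark, not_or, and_assoc]
  split_ifs with h
  · exact iff_of_true rfl h
  · exact iff_of_false (by simp) h

theorem numberMark_eq_one_iff {k x r c : ℕ} (hx : x ≠ 1) : numberMark k x r c = .num 1 ↔
    ¬ (r = 2 * k + 2 ∨ c = 2 * k + 2 ∨ IsSingle k r c) ∧
      (IsRim k r ∨ IsRim k c ∨ IsBehind k r c) := by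
  unfold numberMark
  split_ifs with h1 h2 h3
  · exact iff_of_false (by simpa using hx) fun h => h.1 (Or.inl h1.1)
  · exact iff_of_false (by simp) fun h => h.1 (Or.inr (Or.inr h2))
  · refine iff_of_true rfl ⟨?_, Or.inr (Or.inr h3)⟩
    rintro (h | h | h)
    · omega
    · omega
    · exact h2 h
  · rw [emptyMark_eq_one_iff]
    simp only [h2, h3, or_false]

theorem mark_eq_one_iff : (G.toWataridori k).mark a = .num 1 ↔
    ¬ G.OffCorner a ∧ (IsRim k (row k a) ∨ IsRim k (col k a) ∨
      (G.label (block k a) ≠ none ∧ IsBehind k (row k a) (col k a))) := by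
  unfold OffCorner
  rcases hX : G.label (block k a) with _ | i
  · rw [G.mark_of_none hX, emptyMark_eq_one_iff]
    simp only [ne_eq, not_true_eq_false, false_and, or_false]
  · rw [G.mark_of_some hX, numberMark_eq_one_iff (by omega)]
    simp only [ne_eq, reduceCtorEq, not_false_eq_true, true_and]

/-- All cells of a corner piece that border on other pieces contain a circle with number 1. -/
theorem OffCorner.of_adj (ha : G.OffCorner a) (h : (grid _ _).Adj a b)
    (hb : (G.toWataridori k).mark b ≠ .num 1) : G.OffCorner b := by
  by_contra hn
  refine hb (mark_eq_one_iff.2 ⟨hn, ?_⟩)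
  have hr := row_le k a
  have hc := col_le k a
  unfold OffCorner at ha hn
  rcases adj_cases h with ⟨e, h⟩ | h
  · rw [e] at ha
    by_cases hl : G.label (block k b) = none
    · simp only [hl, ne_eq, not_true_eq_false, false_and, or_false] at ha hn ⊢
      omega
    · simp only [hl, ne_eq, not_false_eq_true, true_and] at ha hn ⊢
      generalize row k a = r at *
      generalize col k a = c at *
      generalize row k b = r' at *
      generalize col k b = c' at *
      rcases ha with ha | ha | (⟨_, _, ha | ha⟩ | ⟨_, _, ha | ha⟩ | ⟨_, _, ha | ha⟩ |
        ⟨_, _, ha | ha⟩) <;>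
        rcases h with ⟨rfl, rfl | rfl⟩ | ⟨rfl, rfl | rfl⟩ <;> grind
  · omega

theorem mem_of_adj {d : Dir} (ha : G.OffCorner a) (hb : G.OffCorner b)
    (hd : d.Mem k (row k a) (col k a))
    (h : LocalAdj (row k a) (col k a) (row k b) (col k b)) :
    d.Mem k (row k b) (col k b) ∨ b = center k (block k b) := by
  rw [eq_cell_iff (by omega) (by omega)]
  simp only [true_and]
  have hr := row_le k b
  have hc := col_le k b
  replace ha : row k a = 2 * k + 2 ∨ col k a = 2 * k + 2 ∨ IsSingle k (row k a) (col k a) :=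
    ha.imp_right (Or.imp_right And.right)
  replace hb : row k b = 2 * k + 2 ∨ col k b = 2 * k + 2 ∨ IsSingle k (row k b) (col k b) :=
    hb.imp_right (Or.imp_right And.right)
  generalize row k a = r at *
  generalize col k a = c at *
  generalize row k b = r' at *
  generalize col k b = c' at *
  cases d <;> simp only [Dir.Mem] at hd ⊢ <;>
    rcases h with ⟨rfl, rfl | rfl⟩ | ⟨rfl, rfl | rfl⟩ <;> omega

theorem exists_mem_of_across (hb : G.OffCorner b) (h : AcrossBorder k (block k a) (block k b)
    (row k a) (col k a) (row k b) (col k b)) :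
    ∃ d : Dir, d.Mem k (row k b) (col k b) ∧ b = armEnd k (block k b) d := by
  replace hb : row k b = 2 * k + 2 ∨ col k b = 2 * k + 2 ∨ IsSingle k (row k b) (col k b) :=
    hb.imp_right (Or.imp_right And.right)
  have key : ∀ d : Dir, row k b = d.row k (2 * k + 2) 0 → col k b = d.col k (2 * k + 2) 0 →
      d.Mem k (row k b) (col k b) ∧ b = armEnd k (block k b) d := by
    intro d h1 h2
    constructor
    · rw [h1, h2]; cases d <;> simp only [Dir.Mem, Dir.row, Dir.col] <;> omega
    · rw [armEnd, arm, ← h1, ← h2, cell_block]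
  rcases h with ⟨-, h1, ⟨-, h2, h3⟩ | ⟨-, h2, h3⟩⟩ | ⟨-, h1, ⟨-, h2, h3⟩ | ⟨-, h2, h3⟩⟩
  · exact ⟨.west, key _ (by simp only [Dir.row]; omega) (by simp only [Dir.col]; omega)⟩
  · exact ⟨.east, key _ (by simp only [Dir.row]; omega) (by simp only [Dir.col]; omega)⟩
  · exact ⟨.north, key _ (by simp only [Dir.row]; omega) (by simp only [Dir.col]; omega)⟩
  · exact ⟨.south, key _ (by simp only [Dir.row]; omega) (by simp only [Dir.col]; omega)⟩

theorem eq_armEnd_of_across {d : Dir} (ha : G.OffCorner a) (hd : d.Mem k (row k a) (col k a))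
    (h : AcrossBorder k (block k a) (block k b) (row k a) (col k a) (row k b) (col k b)) :
    a = armEnd k (block k a) d := by
  replace ha : row k a = 2 * k + 2 ∨ col k a = 2 * k + 2 ∨ IsSingle k (row k a) (col k a) :=
    ha.imp_right (Or.imp_right And.right)
  rw [armEnd, arm, eq_cell_iff (by cases d <;> simp only [Dir.row] <;> omega)
    (by cases d <;> simp only [Dir.col] <;> omega)]
  refine ⟨rfl, ?_⟩
  cases d <;> simp only [Dir.row, Dir.col, Dir.Mem] at hd ⊢ <;> omega

/-- Across the border of its block, a cell off the corners has only one neighbour. -/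
theorem across_unique {b' : Fin ((4 * k + 5) * m) × Fin ((4 * k + 5) * n)} (ha : G.OffCorner a)
    (h : AcrossBorder k (block k a) (block k b) (row k a) (col k a) (row k b) (col k b))
    (h' : AcrossBorder k (block k a) (block k b') (row k a) (col k a) (row k b') (col k b')) :
    b = b' := by
  replace ha : row k a = 2 * k + 2 ∨ col k a = 2 * k + 2 ∨ IsSingle k (row k a) (col k a) :=
    ha.imp_right (Or.imp_right And.right)
  apply cell_ext (k := k)
  · ext <;> omega
  · omega
  · omega

theorem AcrossBorder.adj {X Y : Fin m × Fin n} {r c r' c' : ℕ}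
    (h : AcrossBorder k X Y r c r' c') : (grid m n).Adj X Y := by
  rw [grid_adj]; omega

/-- A path from the center of the block of `A` to the center of the block of `B` that meets no
circle with number 1 passes through the centers of the blocks along some walk from `A` to `B`. -/
theorem exists_walk_of_center_path {A B : Fin m × Fin n}
    (P : (grid ((4 * k + 5) * m) ((4 * k + 5) * n)).Path (center k A) (center k B))
    (hP : ∀ c ∈ P.1.support, (G.toWataridori k).mark c ≠ .num 1) :
    ∃ w : (grid m n).Walk A B, ∀ X ∈ w.support, center k X ∈ P.1.support := by
  obtain ⟨w, hw⟩ := P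
  simp only at hP ⊢
  -- `X` is the block whose center was visited last. Either the path is still in this block, or it
  -- is in the arm of a neighbouring block that faces `X`, and the cell of `X` next to the end of
  -- this arm has been visited.
  have key : ∀ t ≤ w.length, G.OffCorner (w.getVert t) ∧
      ∃ X, (∃ W : (grid m n).Walk A X, ∀ Z ∈ W.support, center k Z ∈ w.support) ∧
        (block k (w.getVert t) = X ∨
          ((grid m n).Adj X (block k (w.getVert t)) ∧
          ∃ d : Dir, d.Mem k (row k (w.getVert t)) (col k (w.getVert t)) ∧ ∃ t' ≤ t,
            AcrossBorder k (block k (w.getVert t)) (block k (w.getVert t'))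
              (row k (armEnd k (block k (w.getVert t)) d))
              (col k (armEnd k (block k (w.getVert t)) d))
              (row k (w.getVert t')) (col k (w.getVert t')))) := by
    intro t
    induction t with
    | zero =>
      intro _
      rw [SimpleGraph.Walk.getVert_zero]
      refine ⟨Or.inl (row_cell _ _ (by omega)), A, ⟨.nil, by simp⟩, Or.inl (block_cell _ _ _ _)⟩
    | succ t ih =>
      intro ht
      obtain ⟨ho, X, ⟨W, hW⟩, hX⟩ := ih (by omega)
      have hadj := w.adj_getVert_succ (show t < w.length by omega)
      have ho' := ho.of_adj hadj (hP _ (w.getVert_mem_support _))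
      refine ⟨ho', ?_⟩
      rcases adj_cases hadj with ⟨e, hl⟩ | hx
      · rcases hX with hX | ⟨hXY, d, hd, t', htt, hx'⟩
        · exact ⟨X, ⟨W, hW⟩, Or.inl (e ▸ hX)⟩
        · rcases mem_of_adj ho ho' hd hl with hd' | hc
          · refine ⟨X, ⟨W, hW⟩, Or.inr ⟨e ▸ hXY, d, hd', t', by omega, ?_⟩⟩
            rw [← e]; exact hx'
          · refine ⟨block k (w.getVert (t + 1)), ⟨W.concat (e ▸ hXY), ?_⟩, Or.inl rfl⟩
            intro Z hZ
            rw [SimpleGraph.Walk.support_concat, List.mem_append,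
              List.mem_singleton] at hZ
            rcases hZ with hZ | rfl
            · exact hW Z hZ
            · rw [← hc]; exact w.getVert_mem_support _
      · rcases hX with hX | ⟨hXY, d, hd, t', htt, hx'⟩
        · obtain ⟨d, hd, he⟩ := exists_mem_of_across ho' hx
          refine ⟨X, ⟨W, hW⟩, Or.inr ⟨hX ▸ AcrossBorder.adj hx, d, hd, t, by omega, ?_⟩⟩
          rw [← he]
          omega
        · -- Leaving the arm towards `X` would lead back to a cell already visited.
          exfalso
          rw [← eq_armEnd_of_across ho hd hx] at hx'
          have := hw.getVert_injOn (by simp; omega) (by simp; omega) (across_unique ho hx hx')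
          omega
  obtain ⟨-, X, ⟨W, hW⟩, hX⟩ := key w.length le_rfl
  rw [SimpleGraph.Walk.getVert_length] at hX
  rcases hX with hX | ⟨-, d, hd, -⟩
  · rw [block_cell] at hX
    subst hX
    exact ⟨W, hW⟩
  · rw [row_cell _ _ (by omega), col_cell _ _ (by omega)] at hd
    cases d <;> simp only [Dir.Mem] at hd <;> omega

/-! ### From Wataridori to Numberlink -/

theorem solvable_of_toWataridori_solvable (h : (G.toWataridori k).Solvable) : G.Solvable := by
  obtain ⟨ι, s, t, P, hne, hmark, hdisj, -, hcount⟩ := h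
  have hend : ∀ i j c, c ∈ (P j).1.support → (c = s i ∨ c = t i) → c = s j ∨ c = t j := by
    intro i j c hc h
    by_contra hn
    have hij : j ≠ i := by rintro rfl; exact hn h
    refine hdisj j i hij c hc ?_
    rcases h with rfl | rfl <;> simp
  -- The two ends of a path carry the same number.
  have hnum : ∀ j x y, (G.toWataridori k).mark (s j) = .num x →
      (G.toWataridori k).mark (t j) = .num y → x = y := fun j x y hx hy =>
    (hcount j x (Or.inl hx)).symm.trans (hcount j y (Or.inr hy))
  have hother : ∀ {i : Fin p} {c}, (G.toWataridori k).mark c =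
      .num (4 * k + 2 * (i.val + 1) + 1) → ∃ X, c = center k X ∧ G.label X = some i := by
    intro i c hc
    rcases G.mark_cases c with h | h | ⟨X, i', rfl, hX⟩
    · simp [h] at hc
    · rw [h, Mark.num.injEq] at hc; omega
    · rw [G.mark_center hX, Mark.num.injEq] at hc
      obtain rfl : i' = i := Fin.ext (by omega)
      exact ⟨X, rfl, hX⟩
  have hnonblank : ∀ j, ∃ x y, (G.toWataridori k).mark (s j) = .num x ∧
      (G.toWataridori k).mark (t j) = .num y := by
    intro j
    have key : ∀ c, (G.toWataridori k).mark c ≠ .blank →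
        ∃ x, (G.toWataridori k).mark c = .num x := by
      intro c hc
      rcases G.mark_cases c with h | h | ⟨X, i', rfl, hX⟩
      · exact absurd h hc
      · exact ⟨_, h⟩
      · exact ⟨_, G.mark_center hX⟩
    obtain ⟨x, hx⟩ := key _ ((hmark (s j)).2 ⟨j, Or.inl rfl⟩)
    obtain ⟨y, hy⟩ := key _ ((hmark (t j)).2 ⟨j, Or.inr rfl⟩)
    exact ⟨x, y, hx, hy⟩
  have hpath : ∀ i : Fin p, ∃ j A B, s j = center k A ∧ t j = center k B ∧
      G.label A = some i ∧ G.label B = some i := by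
    intro i
    obtain ⟨X, Y, -, hXY⟩ := Set.ncard_eq_two.1 (G.twice i)
    have hX : G.label X = some i := by
      have : X ∈ {c | G.label c = some i} := by rw [hXY]; simp
      exact this
    have hm := G.mark_center (k := k) hX
    obtain ⟨j, hj⟩ := (hmark (center k X)).1 (by rw [hm]; simp)
    obtain ⟨x, y, hx, hy⟩ := hnonblank j
    obtain rfl := hnum j x y hx hy
    have hxi : Mark.num x = .num (4 * k + 2 * (i.val + 1) + 1) := by
      rcases hj with hj | hj
      · rw [← hm, hj, hx]
      · rw [← hm, hj, hy]
    obtain ⟨A, hA, hA'⟩ := hother (hx.trans hxi)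
    obtain ⟨B, hB, hB'⟩ := hother (hy.trans hxi)
    exact ⟨j, A, B, hA, hB, hA', hB'⟩
  choose j A B hA hB hA' hB' using hpath
  have hwalk : ∀ i, ∃ w : (grid m n).Walk (A i) (B i),
      ∀ X ∈ w.support, center k X ∈ (P (j i)).1.support := by
    intro i
    have h2 : ∀ c ∈ (P (j i)).1.support, (G.toWataridori k).mark c ≠ .num 1 := by
      intro c hc h1
      obtain ⟨i', hi'⟩ := (hmark c).1 (by rw [h1]; simp)
      rcases hend i' (j i) c hc hi' with rfl | rfl
      · rw [hA, G.mark_center (hA' i), Mark.num.injEq] at h1; omega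
      · rw [hB, G.mark_center (hB' i), Mark.num.injEq] at h1; omega
    have hA := hA i
    have hB := hB i
    revert h2
    generalize P (j i) = Q
    revert Q
    rw [hA, hB]
    exact fun Q hQ => exists_walk_of_center_path Q hQ
  choose w hw using hwalk
  refine ⟨A, B, fun i => (w i).toPath, fun i => ⟨fun e => hne (j i) ?_, hA' i, hB' i⟩, ?_⟩
  · rw [hA, hB, e]
  · intro i i' hii c hc hc'
    have hj : j i ≠ j i' := by
      intro e
      have h1 := hA i
      rw [e, hA i'] at h1
      have h2 := hA' i'
      rw [center_injective k h1, hA' i] at h2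
      exact hii (Option.some.inj h2)
    exact hdisj _ _ hj _ (hw i c ((w i).support_bypass_subset_support hc))
      (hw i' c ((w i').support_bypass_subset_support hc'))

end Numberlink

/-! ### Walks given by sequences of vertices -/

theorem SimpleGraph.exists_path_of_seq {V : Type*} {Γ : SimpleGraph V} (F : ℕ → V) (l : ℕ)
    (hadj : ∀ x < l, Γ.Adj (F x) (F (x + 1))) (hinj : Set.InjOn F (Set.Iic l)) :
    ∃ P : Γ.Path (F 0) (F l), P.1.length = l ∧ ∀ x ≤ l, P.1.getVert x = F x := by
  have key : ∀ (l : ℕ) (F : ℕ → V), (∀ x < l, Γ.Adj (F x) (F (x + 1))) →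
      ∃ w : Γ.Walk (F 0) (F l), w.length = l ∧ ∀ x ≤ l, w.getVert x = F x := by
    intro l
    induction l with
    | zero =>
      intro F _
      exact ⟨.nil, rfl, fun x hx => by obtain rfl : x = 0 := by omega
                                       rfl⟩
    | succ l ih =>
      intro F h
      obtain ⟨w, hl, hw⟩ := ih (fun x => F (x + 1)) (fun x hx => h (x + 1) (by omega))
      refine ⟨.cons (h 0 (by omega)) w, by simp [hl], ?_⟩
      rintro (_ | x) hx
      · simp
      · rw [SimpleGraph.Walk.getVert_cons_succ]
        exact hw x (by omega)
  obtain ⟨w, hl, hw⟩ := key l F hadj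
  refine ⟨⟨w, ?_⟩, hl, hw⟩
  rw [SimpleGraph.Walk.isPath_iff_injective_get_support]
  intro a b hab
  have ha := a.isLt.trans_eq w.length_support
  have hb := b.isLt.trans_eq w.length_support
  have e : ∀ x : Fin w.support.length, w.support.get x = F x := by
    intro x
    have hx := x.isLt.trans_eq w.length_support
    rw [← hw x (by omega), SimpleGraph.Walk.getVert_eq_support_getElem _ (by omega)]
    rfl
  exact Fin.ext (hinj (by simp; omega) (by simp; omega) ((e a).symm.trans (hab.trans (e b))))

theorem SimpleGraph.reachable_of_seq {V : Type*} {Γ : SimpleGraph V} (F : ℕ → V) {x y : ℕ}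
    (hxy : x ≤ y) (hadj : ∀ z, x ≤ z → z < y → Γ.Adj (F z) (F (z + 1))) :
    Γ.Reachable (F x) (F y) := by
  induction y, hxy using Nat.le_induction with
  | base => rfl
  | succ y hy ih => exact (ih fun z h1 h2 => hadj z h1 (by omega)).trans
                      (hadj y hy (by omega)).reachable

/-! ### Counting regions along a walk -/

namespace Wataridori

variable {M N : ℕ} (H : Wataridori M N) {u v : Fin M × Fin N} (w : (grid M N).Walk u v)
  {σ : ℕ → ℕ}

/-- If the regions met by a walk can be numbered in such a way that the numbers never decrease along
the walk, then it does not re-enter a region. -/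
theorem noReentry_of_monotone (hσ : Monotone σ) (h : ∀ x ≤ w.length, ∀ y ≤ w.length,
    H.region (w.getVert x) (w.getVert y) ↔ σ x = σ y) : H.NoReentry w := by
  intro a b c hab hbc hc hr
  rw [h a (by omega) c hc] at hr
  rw [h a (by omega) b (by omega)]
  exact le_antisymm (hσ hab) (hr ▸ hσ hbc)

theorem regionCount_eq {K : ℕ} (hK : ∀ x ≤ w.length, σ x ≤ K)
    (hsurj : ∀ y ≤ K, ∃ x ≤ w.length, σ x = y) (h : ∀ x ≤ w.length, ∀ y ≤ w.length,
    H.region (w.getVert x) (w.getVert y) ↔ σ x = σ y) : H.regionCount w = K + 1 := by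
  choose! g hg hg' using hsurj
  have e : {q : Quotient H.region | ∃ c ∈ w.support, Quotient.mk H.region c = q} =
      (fun y => Quotient.mk H.region (w.getVert (g y))) '' (Finset.range (K + 1) : Set ℕ) := by
    ext q
    simp only [Set.mem_ofPred_eq, Set.mem_image, Finset.coe_range, Set.mem_Iio]
    constructor
    · rintro ⟨c, hc, rfl⟩
      obtain ⟨x, rfl, hx⟩ := SimpleGraph.Walk.mem_support_iff_exists_getVert.1 hc
      have := hK x hx
      refine ⟨σ x, by omega, Quotient.sound ?_⟩
      exact (h _ (hg _ this) _ hx).2 (hg' _ this)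
    · rintro ⟨y, -, rfl⟩
      exact ⟨_, w.getVert_mem_support _, rfl⟩
  rw [regionCount, e, Set.InjOn.ncard_image, Set.ncard_coe_finset, Finset.card_range]
  intro x hx y hy hxy
  simp only [Finset.coe_range, Set.mem_Iio] at hx hy
  have := (h _ (hg x (by omega)) _ (hg y (by omega))).1 (Quotient.exact hxy)
  rwa [hg' x (by omega), hg' y (by omega)] at this

end Wataridori

namespace Numberlink

variable {m n p : ℕ} (G : Numberlink m n p) {k : ℕ}
  {a b : Fin ((4 * k + 5) * m) × Fin ((4 * k + 5) * n)}

/-! ### Paths on the road -/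

theorem piece_arm_of_none {X : Fin m × Fin n} (hX : G.label X = none) (d : Dir) {x : ℕ}
    (hx : x ≤ 2 * k + 2) : G.piece k (arm k X d x 0) = .road := by
  rw [G.piece_of_none (by rwa [block_arm]), row_arm _ _ hx (by omega), col_arm _ _ hx (by omega),
    emptyPiece, if_pos]
  cases d <;> simp [Dir.row, Dir.col]

theorem piece_armEnd (X : Fin m × Fin n) (d : Dir) : G.piece k (armEnd k X d) = .road := by
  rcases hX : G.label X with _ | i
  · exact G.piece_arm_of_none hX d le_rfl
  · rw [G.piece_of_some (i := i) (by rwa [block_arm]), row_arm _ _ le_rfl (by omega),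
      col_arm _ _ le_rfl (by omega), numberPiece, if_neg, if_neg, emptyPiece, if_pos]
    all_goals cases d <;> simp only [Dir.row, Dir.col] <;> grind

/-- Adjacency of road cells in the blocks of the cells in `S`. -/
def roadGraph (k : ℕ) (S : Set (Fin m × Fin n)) :
    SimpleGraph (Fin ((4 * k + 5) * m) × Fin ((4 * k + 5) * n)) where
  Adj a b := (grid _ _).Adj a b ∧ (G.piece k a = .road ∧ block k a ∈ S) ∧
    (G.piece k b = .road ∧ block k b ∈ S)
  symm := ⟨fun _ _ h => ⟨h.1.symm, h.2.2, h.2.1⟩⟩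
  loopless := ⟨fun _ h => h.1.ne rfl⟩

theorem reachable_armEnd_of_none {S : Set (Fin m × Fin n)} {X : Fin m × Fin n} (hS : X ∈ S)
    (hX : G.label X = none) (d e : Dir) :
    (G.roadGraph k S).Reachable (armEnd k X d) (armEnd k X e) := by
  have key : ∀ d, (G.roadGraph k S).Reachable (center k X) (armEnd k X d) := by
    intro d
    rw [← arm_zero k X d]
    refine SimpleGraph.reachable_of_seq (fun x => arm k X d x 0) (Nat.zero_le (2 * k + 2)) ?_
    intro x _ hx
    refine ⟨adj_arm X d (by omega) (by omega) (by omega) (by omega) (by omega), ⟨?_, ?_⟩, ?_, ?_⟩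
    · exact G.piece_arm_of_none hX d (by omega)
    · rwa [block_arm]
    · exact G.piece_arm_of_none hX d (by omega)
    · rwa [block_arm]
  exact (key d).symm.trans (key e)

theorem exists_reachable_armEnd {S : Set (Fin m × Fin n)} {X Y : Fin m × Fin n}
    (w : (grid m n).Walk X Y) (hw : w.IsPath) (hne : X ≠ Y) (hS : ∀ Z ∈ w.support, Z ∈ S)
    (hempty : ∀ Z ∈ w.support, Z ≠ X → Z ≠ Y → G.label Z = none) :
    ∃ d e, (G.roadGraph k S).Reachable (armEnd k X d) (armEnd k Y e) := by
  induction w with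
  | nil => exact absurd rfl hne
  | @cons X Z Y h w ih =>
    have hX : X ∈ S := hS X (by simp)
    have hZ : Z ∈ S := hS Z (by simp)
    obtain ⟨d, e, hde⟩ := exists_adj_armEnd (k := k) h
    have hde' : (G.roadGraph k S).Reachable (armEnd k X d) (armEnd k Z e) :=
      SimpleGraph.Adj.reachable ⟨hde, ⟨G.piece_armEnd _ _, by rwa [block_arm]⟩,
        ⟨G.piece_armEnd _ _, by rwa [block_arm]⟩⟩
    by_cases hZY : Z = Y
    · subst hZY
      exact ⟨d, e, hde'⟩
    · rw [SimpleGraph.Walk.cons_isPath_iff] at hw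
      obtain ⟨d', e', h'⟩ := ih hw.1 hZY (fun W hW => hS W (by simp [hW])) fun W hW h1 h2 =>
        hempty W (by simp [hW]) (by rintro rfl; exact hw.2 hW) h2
      exact ⟨d, e', (hde'.trans (G.reachable_armEnd_of_none hZ
        (hempty Z (by simp) h.ne' hZY) e d')).trans h'⟩

theorem exists_road_path {X Y : Fin m × Fin n} (P : (grid m n).Path X Y) (hne : X ≠ Y)
    (hempty : ∀ Z ∈ P.1.support, Z ≠ X → Z ≠ Y → G.label Z = none) :
    ∃ d e, ∃ Q : (grid _ _).Path (armEnd k X d) (armEnd k Y e),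
      ∀ c ∈ Q.1.support, G.piece k c = .road ∧ block k c ∈ P.1.support := by
  obtain ⟨d, e, ⟨w⟩⟩ := G.exists_reachable_armEnd (k := k) (S := {Z | Z ∈ P.1.support}) P.1 P.2 hne
    (fun Z hZ => hZ) hempty
  have hle : G.roadGraph k {Z | Z ∈ P.1.support} ≤ grid _ _ := fun _ _ h => h.1
  refine ⟨d, e, (w.mapLe hle).toPath, fun c hc => ?_⟩
  replace hc := SimpleGraph.Walk.support_bypass_subset_support _ hc
  rw [SimpleGraph.Walk.support_mapLe_eq_support] at hc
  clear hempty hne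
  have key : ∀ u v (w : (G.roadGraph k {Z | Z ∈ P.1.support}).Walk u v),
      (G.piece k u = .road ∧ block k u ∈ P.1.support) → ∀ c ∈ w.support,
      G.piece k c = .road ∧ block k c ∈ P.1.support := by
    intro u v w
    induction w with
    | nil => intro h c hc; simp only [SimpleGraph.Walk.support_nil, List.mem_singleton] at hc
             subst hc; exact h
    | cons h w ih =>
      intro h' c hc
      rw [SimpleGraph.Walk.support_cons, List.mem_cons] at hc
      rcases hc with rfl | hc
      · exact h'
      · exact ih h.2.2 c hc
  exact key _ _ w ⟨G.piece_armEnd _ _, by rw [block_arm]; simp⟩ c hc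

/-! ### Zigzags through the arms of a number block -/

/-- The distance from the center after `t` steps of the path along an arm that uses both lanes in
the first `2 j` columns of the strip. The first of four consecutive steps in a pair of columns
enters it in lane `0`; the others are a change of lane, a step outward, and the change back. -/
def zigDist (j t : ℕ) : ℕ :=
  if t < 2 then t else if t < 2 + 4 * j then 2 + 2 * ((t - 2) / 4) + (t - 2) % 4 / 2 else t - 2 * j

/-- The lane after `t` steps of the path described at `zigDist`. -/
def zigLane (j t : ℕ) : ℕ :=
  if 2 ≤ t ∧ t < 2 + 4 * j ∧ ((t - 2) % 4 = 1 ∨ (t - 2) % 4 = 2) then 1 else 0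

theorem zigLane_le (j t : ℕ) : zigLane j t ≤ 1 := by
  unfold zigLane; split_ifs <;> omega

theorem zigDist_le {j t : ℕ} (hj : j ≤ k) (ht : t ≤ 2 * k + 2 + 2 * j) :
    zigDist j t ≤ 2 * k + 2 := by
  unfold zigDist; split_ifs <;> omega

theorem localAdj_zig (j t : ℕ) :
    LocalAdj (zigDist j t) (zigLane j t) (zigDist j (t + 1)) (zigLane j (t + 1)) := by
  unfold zigDist zigLane LocalAdj
  split_ifs <;> omega

theorem zig_injective {j t t' : ℕ} (h : zigDist j t = zigDist j t')
    (h' : zigLane j t = zigLane j t') : t = t' := by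
  unfold zigDist at h
  unfold zigLane at h'
  split_ifs at h h' <;> omega

/-- The cell reached after `t` steps of the path described at `zigDist`. It starts in the center
and reaches the end of the arm after `2 k + 2 + 2 j` steps. -/
def zig (k : ℕ) (X : Fin m × Fin n) (d : Dir) (j t : ℕ) :
    Fin ((4 * k + 5) * m) × Fin ((4 * k + 5) * n) :=
  arm k X d (zigDist j t) (zigLane j t)

@[simp] theorem block_zig (X : Fin m × Fin n) (d : Dir) (j t : ℕ) : block k (zig k X d j t) = X :=
  block_arm _ _ _ _ _

theorem zig_zero (X : Fin m × Fin n) (d : Dir) (j : ℕ) : zig k X d j 0 = center k X :=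
  arm_zero k X d

theorem zig_end (X : Fin m × Fin n) (d : Dir) {j : ℕ} (hj : j ≤ k) :
    zig k X d j (2 * k + 2 + 2 * j) = armEnd k X d := by
  have h1 : zigDist j (2 * k + 2 + 2 * j) = 2 * k + 2 := by
    unfold zigDist; split_ifs <;> omega
  have h2 : zigLane j (2 * k + 2 + 2 * j) = 0 := by
    unfold zigLane; split_ifs <;> omega
  rw [zig, h1, h2]

theorem adj_zig (X : Fin m × Fin n) (d : Dir) {j t : ℕ} (hj : j ≤ k) (ht : t < 2 * k + 2 + 2 * j) :
    (grid _ _).Adj (zig k X d j t) (zig k X d j (t + 1)) :=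
  adj_arm X d (zigDist_le hj (by omega)) (zigLane_le _ _) (zigDist_le hj (by omega))
    (zigLane_le _ _) (localAdj_zig j t)

theorem zig_injOn (X : Fin m × Fin n) (d : Dir) {j : ℕ} (hj : j ≤ k) :
    Set.InjOn (zig k X d j) (Set.Iic (2 * k + 2 + 2 * j)) := by
  intro t ht t' ht' h
  have h1 := zigDist_le hj (Set.mem_Iic.1 ht)
  have h2 := zigDist_le hj (Set.mem_Iic.1 ht')
  have h3 := zigLane_le j t
  have h4 := zigLane_le j t'
  have hr := congrArg (row k) h
  have hc := congrArg (col k) h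
  rw [zig, zig, row_arm X d h1 h3, row_arm X d h2 h4] at hr
  rw [zig, zig, col_arm X d h1 h3, col_arm X d h2 h4] at hc
  apply zig_injective (j := j) <;> cases d <;> simp only [Dir.row, Dir.col] at hr hc <;> omega

variable {G}

theorem piece_zig_core {X : Fin m × Fin n} {i : Fin p} (hX : G.label X = some i) (d : Dir) (j : ℕ)
    {t : ℕ} (ht : t < 2) : G.piece k (zig k X d j t) = .core := by
  have h1 : zigDist j t = t := by unfold zigDist; rw [if_pos ht]
  have h2 : zigLane j t = 0 := by unfold zigLane; rw [if_neg (by omega)]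
  rw [G.piece_of_some (i := i) (by rwa [block_zig]), zig, h1, h2, row_arm X d (by omega) (by omega),
    col_arm X d (by omega) (by omega), numberPiece, if_neg, if_pos]
  all_goals cases d <;> simp only [Dir.row, Dir.col] <;> grind

theorem piece_zig_single {X : Fin m × Fin n} {i : Fin p} (hX : G.label X = some i) (d : Dir)
    {j t : ℕ} (hj : j ≤ k) (ht : 2 ≤ t) (ht' : t < 2 * k + 2 + 2 * j) :
    G.piece k (zig k X d j t) = .single (row k (zig k X d j t)) (col k (zig k X d j t)) := by
  have h1 := zigDist_le hj ht'.le
  have h2 := zigLane_le j t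
  have h3 : 2 ≤ zigDist j t ∧ zigDist j t ≤ 2 * k + 1 := by
    unfold zigDist; split_ifs <;> omega
  rw [G.piece_of_some (i := i) (by rwa [block_zig]), numberPiece, if_pos]
  rw [zig, row_arm X d h1 h2, col_arm X d h1 h2]
  cases d <;> simp only [Dir.row, Dir.col] <;> omega

variable (G)

/-! ### Linking two numbers -/

theorem piece_eq_of_region (h : (G.toWataridori k).region a b) :
    G.piece k a = G.piece k b ∧ (block k a = block k b ∨ G.piece k a = .road) := by
  obtain ⟨w⟩ : (G.openGraph k).Reachable a b := h
  induction w with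
  | nil => exact ⟨rfl, Or.inl rfl⟩
  | cons h w ih =>
    obtain ⟨-, h1, h2⟩ := h
    refine ⟨h1.trans ih.1, ?_⟩
    rcases h2 with h2 | h2
    · rw [h2, h1]; exact ih.2
    · exact Or.inr h2

/-- A path that joins two number cells through empty cells can be traced by a path between the
centers of their blocks. For any `j, j' ≤ k`, zigzags in the first and the last block can make this
path pass through `2 k + 2 j` and `2 k + 2 j'` one-cell regions there, besides two cores and a
single road region. -/
theorem exists_link {s t : Fin m × Fin n} {i i' : Fin p} (hs : G.label s = some i)
    (ht : G.label t = some i') (P : (grid m n).Path s t) (hne : s ≠ t)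
    (hempty : ∀ Z ∈ P.1.support, Z ≠ s → Z ≠ t → G.label Z = none) {j j' : ℕ} (hj : j ≤ k)
    (hj' : j' ≤ k) :
    ∃ Q : (grid _ _).Path (center k s) (center k t),
      (∀ c ∈ Q.1.support, (∀ u l, G.piece k c ≠ .corner u l) ∧ block k c ∈ P.1.support) ∧
      (G.toWataridori k).NoReentry Q.1 ∧
      (G.toWataridori k).regionCount Q.1 = 4 * k + 3 + 2 * (j + j') := by
  obtain ⟨d, e, ⟨R, hRp⟩, hR⟩ := G.exists_road_path (k := k) P hne hempty
  simp only at hR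
  obtain ⟨N, hN⟩ : ∃ N, N = 2 * k + 2 + 2 * j := ⟨_, rfl⟩
  obtain ⟨N', hN'⟩ : ∃ N', N' = 2 * k + 2 + 2 * j' := ⟨_, rfl⟩
  obtain ⟨l, hl⟩ : ∃ l, l = R.length := ⟨_, rfl⟩
  obtain ⟨F, hF⟩ : ∃ F : ℕ → _, F = fun x => if x < N then zig k s d j x else
    if x ≤ N + l then R.getVert (x - N) else zig k t e j' (N + l + N' - x) := ⟨_, rfl⟩
  -- The three parts of the path, overlapping in the ends of the arms.
  have hF1 : ∀ x ≤ N, F x = zig k s d j x := by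
    intro x hx
    rcases hx.lt_or_eq with hx | rfl
    · simp only [hF, if_pos hx]
    · simp only [hF]
      rw [if_neg (by omega), if_pos (by omega), Nat.sub_self, R.getVert_zero, hN, zig_end _ _ hj]
  have hF2 : ∀ x, N ≤ x → x ≤ N + l → F x = R.getVert (x - N) := by
    intro x hx hx'
    simp only [hF]
    rw [if_neg (by omega), if_pos hx']
  have hF3 : ∀ x, N + l ≤ x → F x = zig k t e j' (N + l + N' - x) := by
    intro x hx
    rcases hx.lt_or_eq with hx | rfl
    · simp only [hF]
      rw [if_neg (by omega), if_neg (by omega)]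
    · rw [hF2 _ (by omega) le_rfl, Nat.add_sub_cancel_left, Nat.add_sub_cancel_left, hl,
        R.getVert_length, hN', zig_end _ _ hj']
  have hadj : ∀ x < N + l + N', (grid _ _).Adj (F x) (F (x + 1)) := by
    intro x hx
    rcases lt_or_ge x N with h | h
    · rw [hF1 x h.le, hF1 (x + 1) h]
      exact adj_zig s d hj (by omega)
    · rcases lt_or_ge x (N + l) with h' | h'
      · rw [hF2 x h h'.le, hF2 (x + 1) (by omega) h', show x + 1 - N = x - N + 1 by omega]
        exact R.adj_getVert_succ (by omega)
      · rw [hF3 x h', hF3 (x + 1) (by omega),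
          show N + l + N' - x = N + l + N' - (x + 1) + 1 by omega]
        exact (adj_zig t e hj' (by omega)).symm
  have hroad : ∀ x, N ≤ x → x ≤ N + l → G.piece k (F x) = .road ∧ block k (F x) ∈ P.1.support := by
    intro x h1 h2
    rw [hF2 x h1 h2]
    exact hR _ (R.getVert_mem_support _)
  have hcore : ∀ x < 2, G.piece k (F x) = .core := fun x hx => by
    rw [hF1 x (by omega)]; exact piece_zig_core hs d j hx
  have hsingle : ∀ x, 2 ≤ x → x < N → G.piece k (F x) = .single (row k (F x)) (col k (F x)) :=
    fun x h1 h2 => by rw [hF1 x (by omega)]; exact piece_zig_single hs d hj h1 (by omega)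
  have hcore' : ∀ x ≤ N + l + N', N + l + N' < x + 2 → G.piece k (F x) = .core :=
    fun x h1 h2 => by rw [hF3 x (by omega)]; exact piece_zig_core ht e j' (by omega)
  have hsingle' : ∀ x, N + l < x → x + 2 ≤ N + l + N' →
      G.piece k (F x) = .single (row k (F x)) (col k (F x)) :=
    fun x h1 h2 => by
      rw [hF3 x (by omega)]; exact piece_zig_single ht e hj' (by omega) (by omega)
  have hblock : ∀ x ≤ N, block k (F x) = s := fun x hx => by rw [hF1 x hx, block_zig]
  have hblock' : ∀ x, N + l ≤ x → block k (F x) = t := fun x hx => by rw [hF3 x hx, block_zig]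
  have hinjs : ∀ x ≤ N, ∀ y ≤ N, F x = F y → x = y := by
    intro x hx y hy h
    rw [hF1 x hx, hF1 y hy] at h
    exact zig_injOn s d hj (Set.mem_Iic.2 (by omega)) (Set.mem_Iic.2 (by omega)) h
  have hinjt : ∀ x, N + l ≤ x → x ≤ N + l + N' → ∀ y, N + l ≤ y → y ≤ N + l + N' →
      F x = F y → x = y := by
    intro x hx hx' y hy hy' h
    rw [hF3 x hx, hF3 y hy] at h
    have := zig_injOn t e hj' (Set.mem_Iic.2 (by omega)) (Set.mem_Iic.2 (by omega)) h
    omega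
  -- `σ x` is the number of region borders crossed in the first `x` steps.
  obtain ⟨σ, hσ⟩ : ∃ σ : ℕ → ℕ, ∀ x, σ x = (min x N - 1) + (min x (N + l + N' - 1) - (N + l)) :=
    ⟨_, fun _ => rfl⟩
  have hmono : Monotone σ := fun x y h => by rw [hσ, hσ]; omega
  have key : ∀ x y, x ≤ y → y ≤ N + l + N' → G.piece k (F x) = G.piece k (F y) →
      (block k (F x) = block k (F y) ∨ G.piece k (F x) = .road) →
      σ x = σ y ∧ (F x = F y → x = y) := by
    intro x y hxy hy hp hb
    rw [hσ, hσ]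
    rcases lt_or_ge y N with h1 | h1
    · refine ⟨?_, hinjs x (by omega) y h1.le⟩
      rcases lt_or_ge x 2 with h2 | h2 <;> rcases lt_or_ge y 2 with h3 | h3
      · omega
      · rw [hcore x h2, hsingle y h3 h1] at hp; cases hp
      · omega
      · rw [hsingle x h2 (by omega), hsingle y h3 h1, Piece.single.injEq] at hp
        have := hinjs x (by omega) y h1.le (cell_ext
          ((hblock x (by omega)).trans (hblock y h1.le).symm) hp.1 hp.2)
        omega
    rcases le_or_gt y (N + l) with h2 | h2
    · have hpy := (hroad y h1 h2).1
      rcases lt_or_ge x N with h3 | h3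
      · rw [hpy] at hp
        rcases lt_or_ge x 2 with h4 | h4
        · rw [hcore x h4] at hp; cases hp
        · rw [hsingle x h4 h3] at hp; cases hp
      · refine ⟨by omega, fun h => ?_⟩
        rw [hF2 x h3 (by omega), hF2 y h1 h2] at h
        have := hRp.getVert_injOn (by simp; omega) (by simp; omega) h
        omega
    have hpy : G.piece k (F y) ≠ .road := by
      rcases lt_or_ge (N + l + N') (y + 2) with h4 | h4
      · rw [hcore' y hy h4]; simp
      · rw [hsingle' y h2 h4]; simp
    rw [hp] at hb
    replace hb := hb.resolve_right hpy
    rw [hblock' y h2.le] at hb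
    rcases lt_or_ge x N with h3 | h3
    · exact absurd ((hblock x h3.le).symm.trans hb) hne
    rcases le_or_gt x (N + l) with h4 | h4
    · exact absurd (hp.symm.trans (hroad x h3 h4).1) hpy
    refine ⟨?_, hinjt x h4.le (by omega) y h2.le hy⟩
    rcases lt_or_ge (N + l + N') (x + 2) with h5 | h5 <;>
      rcases lt_or_ge (N + l + N') (y + 2) with h6 | h6
    · omega
    · omega
    · rw [hsingle' x h4 h5, hcore' y hy h6] at hp; cases hp
    · rw [hsingle' x h4 h5, hsingle' y h2 h6, Piece.single.injEq] at hp
      have := hinjt x h4.le (by omega) y h2.le hy (cell_ext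
        ((hblock' x h4.le).trans (hblock' y h2.le).symm) hp.1 hp.2)
      omega
  have hinj : Set.InjOn F (Set.Iic (N + l + N')) := by
    intro x hx y hy h
    rcases le_total x y with hxy | hxy
    · exact (key x y hxy hy (by rw [h]) (by rw [h]; simp)).2 h
    · exact ((key y x hxy hx (by rw [h]) (by rw [h]; simp)).2 h.symm).symm
  have hreach : ∀ x y, x ≤ y → y ≤ N + l + N' → σ x = σ y →
      (G.toWataridori k).region (F x) (F y) := by
    intro x y hxy hy h
    refine SimpleGraph.reachable_of_seq (Γ := G.openGraph k) F hxy fun z h1 h2 => ?_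
    have hz : σ z = σ (z + 1) := by
      have h3 := hmono h1
      have h4 := hmono (Nat.le_succ z)
      have h5 := hmono (Nat.succ_le_of_lt h2)
      simp only [Nat.succ_eq_add_one] at h4 h5
      omega
    rw [hσ, hσ] at hz
    refine ⟨hadj z (by omega), ?_⟩
    obtain h3 | ⟨h3, h4⟩ | h3 : z = 0 ∨ (N ≤ z ∧ z < N + l) ∨ z + 1 = N + l + N' := by omega
    · rw [hcore z (by omega), hcore (z + 1) (by omega), hblock z (by omega),
        hblock (z + 1) (by omega)]
      simp
    · rw [(hroad z h3 h4.le).1, (hroad (z + 1) (by omega) h4).1]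
      simp
    · rw [hcore' z (by omega) (by omega), hcore' (z + 1) (by omega) (by omega),
        hblock' z (by omega), hblock' (z + 1) (by omega)]
      simp
  have hregion : ∀ x ≤ N + l + N', ∀ y ≤ N + l + N',
      (G.toWataridori k).region (F x) (F y) ↔ σ x = σ y := by
    intro x hx y hy
    rcases le_total x y with hxy | hxy
    · refine ⟨fun h => ?_, hreach x y hxy hy⟩
      have := G.piece_eq_of_region h
      exact (key x y hxy hy this.1 this.2).1
    · refine ⟨fun h => ?_, fun h => Setoid.symm' _ (hreach y x hxy hx h.symm)⟩
      have := G.piece_eq_of_region (Setoid.symm' _ h)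
      exact (key y x hxy hx this.1 this.2).1.symm
  obtain ⟨Q, hQl, hQ⟩ := SimpleGraph.exists_path_of_seq F (N + l + N') hadj hinj
  have h0 : F 0 = center k s := by rw [hF1 0 (by omega), zig_zero]
  have h1 : F (N + l + N') = center k t := by rw [hF3 _ (by omega), Nat.sub_self, zig_zero]
  rw [← h0, ← h1]
  have hQr : ∀ x ≤ Q.1.length, ∀ y ≤ Q.1.length,
      (G.toWataridori k).region (Q.1.getVert x) (Q.1.getVert y) ↔ σ x = σ y := by
    intro x hx y hy
    rw [hQl] at hx hy
    rw [hQ x hx, hQ y hy]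
    exact hregion x hx y hy
  refine ⟨Q, ?_, Wataridori.noReentry_of_monotone _ _ hmono hQr, ?_⟩
  · intro c hc
    obtain ⟨x, rfl, hx⟩ := SimpleGraph.Walk.mem_support_iff_exists_getVert.1 hc
    rw [hQl] at hx
    rw [hQ x hx]
    rcases lt_or_ge x N with h2 | h2
    · rw [hblock x h2.le]
      refine ⟨fun u v => ?_, by simp⟩
      rcases lt_or_ge x 2 with h4 | h4
      · rw [hcore x h4]; simp
      · rw [hsingle x h4 h2]; simp
    rcases le_or_gt x (N + l) with h3 | h3
    · rw [(hroad x h2 h3).1]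
      exact ⟨by simp, (hroad x h2 h3).2⟩
    · rw [hblock' x h3.le]
      refine ⟨fun u v => ?_, by simp⟩
      rcases lt_or_ge (N + l + N') (x + 2) with h4 | h4
      · rw [hcore' x hx h4]; simp
      · rw [hsingle' x h3 h4]; simp
  · rw [Wataridori.regionCount_eq _ Q.1 (σ := σ) (K := 4 * k + 2 + 2 * (j + j')) ?_ ?_ hQr]
    · omega
    · intro x hx
      rw [hσ]; omega
    · intro y hy
      rcases lt_or_ge y N with h2 | h2
      · exact ⟨y + 1, by omega, by rw [hσ]; omega⟩
      · exact ⟨y + 1 + l, by omega, by rw [hσ]; omega⟩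

/-! ### Pairing the circles with number 1 -/

/-- The circles with number 1 around a corner piece form a cycle, which is cut into dominoes: this
is the other position of the domino at `(r, c)`. On the two parallel sides of the corner square
that the adjacent strip does not shorten, the dominoes cover the whole side; on the other two,
they cover the positions between these sides. -/
def dominoMate (k r c : ℕ) : ℕ × ℕ :=
  if r < 2 * k + 2 then
    if c < 2 * k + 2 then
      if c = 0 ∨ c = 2 * k + 1 then (r + 1 - 2 * (r % 2), c) else (r, c + 2 * (c % 2) - 1)
    else
      if r = 0 ∨ r = 2 * k + 1 then (r, c + 2 * (c % 2) - 1) else (r + 2 * (r % 2) - 1, c)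
  else
    if c < 2 * k + 2 then
      if r = 2 * k + 3 ∨ r = 4 * k + 4 then (r, c + 1 - 2 * (c % 2))
      else (r + 1 - 2 * (r % 2), c)
    else
      if c = 2 * k + 3 ∨ c = 4 * k + 4 then (r + 2 * (r % 2) - 1, c)
      else (r, c + 1 - 2 * (c % 2))

/-- The circles with number 1 of an empty block (`b = False`) or of a number block (`b = True`). -/
abbrev IsOne (k : ℕ) (b : Prop) (r c : ℕ) : Prop :=
  ¬ (r = 2 * k + 2 ∨ c = 2 * k + 2 ∨ (b ∧ IsSingle k r c)) ∧
    (IsRim k r ∨ IsRim k c ∨ (b ∧ IsBehind k r c))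

/-- The four sides of the cycle of circles in each corner. In a number block, the side along the
adjacent strip is moved inward. -/
theorem isOne_iff {k r c : ℕ} {b : Prop} (hr : r ≤ 4 * k + 4) (hc : c ≤ 4 * k + 4) :
    IsOne k b r c ↔ r ≠ 2 * k + 2 ∧ c ≠ 2 * k + 2 ∧
    if r < 2 * k + 2 then
      if c < 2 * k + 2 then c = 0 ∨ c = 2 * k + 1 ∨ r = 0 ∨ (¬ b ∧ r = 2 * k + 1) ∨ (b ∧ r = 2 * k)
      else r = 0 ∨ r = 2 * k + 1 ∨ c = 4 * k + 4 ∨ (¬ b ∧ c = 2 * k + 3) ∨ (b ∧ c = 2 * k + 4)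
    else
      if c < 2 * k + 2 then
        r = 2 * k + 3 ∨ r = 4 * k + 4 ∨ c = 0 ∨ (¬ b ∧ c = 2 * k + 1) ∨ (b ∧ c = 2 * k)
      else
        c = 2 * k + 3 ∨ c = 4 * k + 4 ∨ r = 4 * k + 4 ∨ (¬ b ∧ r = 2 * k + 3) ∨
          (b ∧ r = 2 * k + 4) := by
  by_cases hb : b
  · simp only [hb, IsOne, true_and, not_true_eq_false, false_and, false_or]
    split_ifs <;> omega
  · simp only [hb, IsOne, true_and, not_false_eq_true, false_and, or_false]
    split_ifs <;> omega

theorem dominoMate_spec {k r c r' c' : ℕ} {b : Prop} (hr : r ≤ 4 * k + 4) (hc : c ≤ 4 * k + 4)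
    (h : IsOne k b r c) (e : dominoMate k r c = (r', c')) :
    LocalAdj r c r' c' ∧ r' ≤ 4 * k + 4 ∧ c' ≤ 4 * k + 4 ∧ IsOne k b r' c' ∧
      dominoMate k r' c' = (r, c) ∧ (r < 2 * k + 2 ↔ r' < 2 * k + 2) ∧
      (c < 2 * k + 2 ↔ c' < 2 * k + 2) := by
  rw [isOne_iff hr hc] at h
  obtain ⟨h1, h2, h⟩ := h
  have key : LocalAdj r c r' c' ∧ r' ≤ 4 * k + 4 ∧ c' ≤ 4 * k + 4 ∧
      dominoMate k r' c' = (r, c) ∧ (r < 2 * k + 2 ↔ r' < 2 * k + 2) ∧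
      (c < 2 * k + 2 ↔ c' < 2 * k + 2) := by
    unfold dominoMate at e ⊢
    split_ifs at e h with h3 h4 h5 h5 <;> cases e <;>
    · refine ⟨by omega, by omega, by omega, ?_, by omega, by omega⟩
      split_ifs <;> first | (exfalso; omega) | (ext <;> simp only <;> omega)
  obtain ⟨k1, k2, k3, k4, k5, k6⟩ := key
  refine ⟨k1, k2, k3, ?_, k4, k5, k6⟩
  rw [isOne_iff k2 k3]
  simp only [← k5, ← k6]
  clear k4
  unfold dominoMate at e
  by_cases hb : b <;>
    simp only [hb, true_and, false_and, not_true_eq_false, not_false_eq_true, false_or,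
      or_false] at h ⊢ <;>
    split_ifs at e h ⊢ with h3 h4 h5 h5 <;> (cases e; omega)
variable {G}

/-- The other cell of the domino of a cell with number 1. -/
def mate (k : ℕ) (a : Fin ((4 * k + 5) * m) × Fin ((4 * k + 5) * n)) :
    Fin ((4 * k + 5) * m) × Fin ((4 * k + 5) * n) :=
  cell k (block k a) (dominoMate k (row k a) (col k a)).1 (dominoMate k (row k a) (col k a)).2

theorem piece_of_mark_eq_one (h : (G.toWataridori k).mark a = .num 1) :
    G.piece k a = .corner (decide (row k a < 2 * k + 2)) (decide (col k a < 2 * k + 2)) := by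
  rw [mark_eq_one_iff] at h
  obtain ⟨h, -⟩ := h
  unfold OffCorner at h
  obtain ⟨h1, h⟩ := not_or.1 h
  obtain ⟨h2, h3⟩ := not_or.1 h
  rcases hX : G.label (block k a) with _ | i
  · rw [G.piece_of_none hX, emptyPiece, if_neg (by omega)]
  · rw [G.piece_of_some hX, numberPiece, if_neg (fun e => h3 ⟨by simp [hX], e⟩),
      if_neg (by omega), emptyPiece, if_neg (by omega)]

theorem mate_spec (h : (G.toWataridori k).mark a = .num 1) :
    (G.toWataridori k).mark (mate k a) = .num 1 ∧ mate k (mate k a) = a ∧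
      (G.openGraph k).Adj a (mate k a) := by
  obtain ⟨h1, h2, h3, h4, h5, h6, h7⟩ :=
    dominoMate_spec (row_le k a) (col_le k a) (mark_eq_one_iff.1 h) (Prod.mk.eta).symm
  have hb : block k (mate k a) = block k a := block_cell _ _ _ _
  have hr : row k (mate k a) = (dominoMate k (row k a) (col k a)).1 := row_cell _ _ h2
  have hc : col k (mate k a) = (dominoMate k (row k a) (col k a)).2 := col_cell _ _ h3
  have hm : (G.toWataridori k).mark (mate k a) = .num 1 := by
    rw [mark_eq_one_iff, OffCorner, hb, hr, hc]
    exact h4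
  refine ⟨hm, ?_, ?_, ?_, Or.inl hb.symm⟩
  · conv_lhs => rw [mate, hb, hr, hc, h5]
    exact cell_block k a
  · conv_lhs => rw [← cell_block k a]
    exact adj_cell _ (row_le k a) (col_le k a) h2 h3 h1
  · rw [piece_of_mark_eq_one h, piece_of_mark_eq_one hm, hr, hc]
    simp only [h6, h7]

theorem exists_domino_path (h : (G.toWataridori k).mark a = .num 1) :
    ∃ Q : (grid _ _).Path a (mate k a), (∀ c ∈ Q.1.support, c = a ∨ c = mate k a) ∧
      (G.toWataridori k).NoReentry Q.1 ∧ (G.toWataridori k).regionCount Q.1 = 1 := by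
  have hadj := (mate_spec h).2.2
  have hs : ∀ c ∈ (SimpleGraph.Path.singleton hadj.1).1.support, c = a ∨ c = mate k a := by
    intro c hc
    simpa [SimpleGraph.Path.singleton] using hc
  have hr : ∀ c ∈ (SimpleGraph.Path.singleton hadj.1).1.support,
      (G.toWataridori k).region a c := by
    intro c hc
    rcases hs c hc with rfl | rfl
    · exact Setoid.refl' _ _
    · exact SimpleGraph.Adj.reachable hadj
  have hr' : ∀ x ≤ (SimpleGraph.Path.singleton hadj.1).1.length,
      ∀ y ≤ (SimpleGraph.Path.singleton hadj.1).1.length, (G.toWataridori k).region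
        ((SimpleGraph.Path.singleton hadj.1).1.getVert x)
        ((SimpleGraph.Path.singleton hadj.1).1.getVert y) ↔ (fun _ => 0 : ℕ → ℕ) x = 0 := by
    intro x _ y _
    exact iff_of_true (Setoid.trans' _
      (Setoid.symm' _ (hr _ (SimpleGraph.Walk.getVert_mem_support _ _)))
      (hr _ (SimpleGraph.Walk.getVert_mem_support _ _))) rfl
  exact ⟨.singleton hadj.1, hs, Wataridori.noReentry_of_monotone _ _ monotone_const hr',
    Wataridori.regionCount_eq _ _ (K := 0) (fun _ _ => le_rfl)
      (fun y hy => ⟨0, by omega, by omega⟩) hr'⟩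

/-! ### From Numberlink to Wataridori -/

theorem toWataridori_solvable (hp : p ≤ 2 * k + 1) (h : G.Solvable) :
    (G.toWataridori k).Solvable := by
  obtain ⟨s, t, P, hst, hdisj⟩ := h
  -- Every number cell is an end of the path of its number.
  have hlabel : ∀ i Z, G.label Z = some i → Z = s i ∨ Z = t i := by
    intro i Z hZ
    obtain ⟨hne, h1, h2⟩ := hst i
    have hsub : {s i, t i} ⊆ {c | G.label c = some i} := by
      rintro c (rfl | rfl)
      · exact h1
      · exact h2
    have heq := Set.eq_of_subset_of_ncard_le hsub (by rw [G.twice i, Set.ncard_pair hne])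
      (Set.toFinite _)
    have : Z ∈ ({s i, t i} : Set _) := by rw [heq]; exact hZ
    exact this
  have hempty : ∀ i, ∀ Z ∈ (P i).1.support, Z ≠ s i → Z ≠ t i → G.label Z = none := by
    intro i Z hZ h1 h2
    by_contra hn
    obtain ⟨i', hi'⟩ := Option.ne_none_iff_exists'.1 hn
    have hZ' := hlabel i' Z hi'
    by_cases hii : i = i'
    · subst hii
      exact hZ'.elim h1 h2
    · refine hdisj i i' hii Z hZ ?_
      rcases hZ' with rfl | rfl <;> simp
  -- The number of the path exceeds that of a path without zigzags by `2 i`; they are distributed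
  -- among the first and the last block.
  choose Q hQ hQr hQc using fun i => exists_link (k := k) (G := G) (hst i).2.1 (hst i).2.2 (P i)
    (hst i).1 (hempty i) (min_le_right i.val k) (j' := i.val - min i.val k)
    (by have := i.isLt; omega)
  choose D hD hDr hDc using fun a : {a // (G.toWataridori k).mark a = .num 1 ∧
    a.1.val + a.2.val < (mate k a).1.val + (mate k a).2.val} => exists_domino_path a.2.1
  have hDone : ∀ a, ∀ c ∈ (D a).1.support, (G.toWataridori k).mark c = .num 1 := by
    intro a c hc
    rcases hD a c hc with rfl | rfl
    · exact a.2.1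
    · exact (mate_spec a.2.1).1
  have hQD : ∀ i a, ∀ c, c ∈ (Q i).1.support → c ∉ (D a).1.support := fun i a c hc hc' =>
    (hQ i c hc).1 _ _ (piece_of_mark_eq_one (hDone a c hc'))
  refine ⟨Fin p ⊕ {a // (G.toWataridori k).mark a = .num 1 ∧
      a.1.val + a.2.val < (mate k a).1.val + (mate k a).2.val},
    Sum.elim (fun i => center k (s i)) (fun a => a.1),
    Sum.elim (fun i => center k (t i)) (fun a => mate k a.1),
    fun j => match j with
      | .inl i => Q i
      | .inr a => D a, ?_, ?_, ?_, ?_, ?_⟩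
  · rintro (i | a) h
    · exact (hst i).1 (center_injective k h)
    · exact (mate_spec a.2.1).2.2.1.ne h
  · intro c
    constructor
    · intro hc
      rcases G.mark_cases c with h | h | ⟨X, i, rfl, hX⟩
      · exact absurd h hc
      · obtain ⟨h1, h2, h3⟩ := mate_spec h
        have h4 := grid_adj.1 h3.1
        rcases lt_or_ge (c.1.val + c.2.val) ((mate k c).1.val + (mate k c).2.val) with h5 | h5
        · exact ⟨.inr ⟨c, h, h5⟩, Or.inl rfl⟩
        · exact ⟨.inr ⟨mate k c, h1, by rw [h2]; omega⟩, Or.inr h2.symm⟩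
      · exact ⟨.inl i, (hlabel i X hX).imp (congrArg _) (congrArg _)⟩
    · rintro ⟨i | a, rfl | rfl⟩ <;> simp only [Sum.elim_inl, Sum.elim_inr]
      · rw [G.mark_center (hst i).2.1]; simp
      · rw [G.mark_center (hst i).2.2]; simp
      · rw [a.2.1]; simp
      · rw [(mate_spec a.2.1).1]; simp
  · rintro (i | a) (i' | a') hne c hc hc'
    · exact hdisj i i' (by rintro rfl; exact hne rfl) _ (hQ i c hc).2 (hQ i' c hc').2
    · exact hQD _ _ c hc hc'
    · exact hQD _ _ c hc' hc
    · have h1 := a.2.2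
      have h2 := a'.2.2
      apply hne
      congr 1
      apply Subtype.ext
      have e1 := (mate_spec a.2.1).2.1
      have e2 := (mate_spec a'.2.1).2.1
      -- A cell of two dominoes determines both, and the order of the two cells the first one.
      rcases hD a c hc with rfl | rfl <;> rcases hD a' _ hc' with h | h
      · exact h
      · rw [h, e2] at h1; omega
      · rw [← h, e1] at h2; omega
      · rw [← e1, h, e2]
  · rintro (i | a)
    · exact hQr i
    · exact hDr a
  · rintro (i | a) x hx
    · simp only [Sum.elim_inl, G.mark_center (hst i).2.1, G.mark_center (hst i).2.2, or_self,
        Mark.num.injEq] at hx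
      exact (hQc i).trans (by omega)
    · simp only [Sum.elim_inr, a.2.1, (mate_spec a.2.1).1, or_self, Mark.num.injEq] at hx
      exact (hDc a).trans hx

end Numberlink

theorem mainTheorem1 (m n p : ℕ) (G : Numberlink m n p) :
    G.Solvable ↔ (G.toWataridori ⌈((p : ℚ) - 1) / 2⌉₊).Solvable := by
  refine ⟨Numberlink.toWataridori_solvable ?_, Numberlink.solvable_of_toWataridori_solvable⟩
  have h := Nat.le_ceil (((p : ℚ) - 1) / 2)
  have h' : (p : ℚ) ≤ 2 * (⌈((p : ℚ) - 1) / 2⌉₊ : ℚ) + 1 := by linarith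
  exact_mod_cast h'
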